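/- Let $m\equiv 0\pmod 4$, $1\le e\le m/2$ and $\gcd(m,e)=2$ (so $m\ge 4$). Let $\alpha$ be a generator of $\mathbb F_{2^m}^*$, let $\mathbb M_\beta$ denote the minimal polynomial of $\beta$ over $\mathbb F_2$, and put, for a finite set $E$ of positive integers, $$g_E(x)=\mathbb M_\alpha(x)\cdot\mathrm{lcm}\{\mathbb M_{\alpha^{1+2^{i}}}(x): i\in E\}.$$ Let $\mathcal C_E$ be the binary cyclic code of length $2^m-1$ with generator polynomial $g_E$, that is, the set of words $(c_0,\dots,c_{2^m-2})\in\mathbb F_2^{2^m-1}$ such that the class of $\sum_i c_ix^i$ lies in the ideal of $\mathbb F_2[x]/(x^{2^m-1}-1)$ generated by $g_E$. Let $\overline{\mathcal C_E}$ be the extended code, obtained by appending the parity element $-\sum_i c_i$ to every codeword. Take $E=\{e\}$. Then $\overline{\mathcal C_E}$ has length $2^m$ and minimum distance $4$. Its dimension is $2^m-1-2m$ if $m\ne 4$, and $9$ if $m=4$. For every $m$ as above, including $m=4$, the number $\overline A_k$ of codewords of Hamming weight $k$ in $\overline{\mathcal C_E}$ satisfies, for all $0\le k\le 2^m$, $$2^{2m+1}\,\overline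 A_k=(1+(-1)^k)\binom{2^m}{k}+w\,E_0(k)+u\,E_1(k)+v\,E_2(k),$$ where $$u=\frac{2^{m-4}(2^m-1)}5,\qquad v=\frac{2^{m+2}(2^m-1)}5,\qquad w=2\,(3\cdot 2^{m-4}+1)(2^m-1),$$ $$E_0(k)=\frac{1+(-1)^k}{2}\,(-1)^{\lfloor k/2\rfloor}\binom{2^{m-1}}{\lfloor k/2\rfloor},$$ $$E_1(k)=\sum_{\substack{0\le i\le 2^{m-1}-2^{(m+2)/2}\\ 0\le j\le 2^{m-1}+2^{(m+2)/2}\\ i+j=k}}\bigl((-1)^i+(-1)^j\bigr)\binom{2^{m-1}-2^{(m+2)/2}}{i}\binom{2^{m-1}+2^{(m+2)/2}}{j},$$ $$E_2(k)=\sum_{\substack{0\le i\le 2^{m-1}-2^{(m-2)/2}\\ 0\le j\le 2^{m-1}+2^{(m-2)/2}\\ i+j=k}}\bigl((-1)^i+(-1)^j\bigr)\binom{2^{m-1}-2^{(m-2)/2}}{i}\binom{2^{m-1}+2^{(m-2)/2}}{j}.$$ -/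

import Mathlib

open Polynomial

noncomputable section

namespace BinaryCode

/-- The linear map sending a word `(c_0, …, c_{n-1})` over `𝔽₂` to the class of
`c_0 + c_1 x + ⋯ + c_{n-1} x^{n-1}` in `𝔽₂[x] / (x^n - 1)`. -/
def wordClass (n : ℕ) :
    (Fin n → ZMod 2) →ₗ[ZMod 2] ((ZMod 2)[X] ⧸ Ideal.span {(X ^ n - 1 : (ZMod 2)[X])}) where
  toFun c := Ideal.Quotient.mk _ (∑ i : Fin n, C (c i) * X ^ (i : ℕ))
  map_add' c d := by
    simp only [Pi.add_apply, add_mul, Finset.sum_add_distrib, map_add]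
  map_smul' a c := by
    have h : ∑ i : Fin n, C ((a • c) i) * X ^ (i : ℕ)
        = a • ∑ i : Fin n, C (c i) * (X : (ZMod 2)[X]) ^ (i : ℕ) := by
      simp only [Pi.smul_apply, smul_eq_mul, C_mul, mul_assoc, smul_eq_C_mul, Finset.mul_sum]
    rw [h]
    exact map_smul (Ideal.Quotient.mkₐ (ZMod 2) _) a _

/-- The binary cyclic code of length `n` generated by `g`: all words whose polynomial lies in the
ideal of `𝔽₂[x] / (x^n - 1)` generated by `g`. -/
def cyclicCode (n : ℕ) (g : (ZMod 2)[X]) : Submodule (ZMod 2) (Fin n → ZMod 2) :=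
  ((Ideal.span {Ideal.Quotient.mk (Ideal.span {(X ^ n - 1 : (ZMod 2)[X])}) g}).restrictScalars
    (ZMod 2)).comap (wordClass n)

/-- Appending the parity element `-(c_0 + ⋯ + c_{n-1})` to a word. -/
def extendWord (n : ℕ) : (Fin n → ZMod 2) →ₗ[ZMod 2] (Fin (n + 1) → ZMod 2) where
  toFun c := Fin.snoc (α := fun _ => ZMod 2) c (-∑ i, c i)
  map_add' c d := by
    funext i
    refine Fin.lastCases ?_ (fun j => ?_) i
    · simp [Finset.sum_add_distrib, add_comm]
    · simp
  map_smul' a c := by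
    funext i
    refine Fin.lastCases ?_ (fun j => ?_) i
    · simp [Finset.mul_sum]
    · simp

/-- The extended code. -/
def extendedCode {n : ℕ} (K : Submodule (ZMod 2) (Fin n → ZMod 2)) :
    Submodule (ZMod 2) (Fin (n + 1) → ZMod 2) :=
  K.map (extendWord n)

/-- The generator polynomial
`g_E = M_α · lcm {M_{α^(1+2^e)} : e ∈ E}`, with `M_β` the minimal polynomial of `β` over `𝔽₂`. -/
def genPoly {F : Type*} [Field F] [Algebra (ZMod 2) F] (α : F) (E : Finset ℕ) : (ZMod 2)[X] :=
  minpoly (ZMod 2) α * E.lcm (fun e => minpoly (ZMod 2) (α ^ (1 + 2 ^ e)))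

/-- The binary cyclic code `C_E` of length `2^m - 1` with generator polynomial `g_E`. -/
def codeE (m : ℕ) {F : Type*} [Field F] [Algebra (ZMod 2) F] (α : F) (E : Finset ℕ) :
    Submodule (ZMod 2) (Fin (2 ^ m - 1) → ZMod 2) :=
  cyclicCode (2 ^ m - 1) (genPoly α E)

/-- The number of codewords of Hamming weight `k`. -/
def weightCount {n : ℕ} (K : Submodule (ZMod 2) (Fin n → ZMod 2)) (k : ℕ) : ℕ :=
  {c : Fin n → ZMod 2 | c ∈ K ∧ hammingNorm c = k}.ncard

/-- `d` is the minimum Hamming weight of the nonzero codewords. -/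
def IsMinDistance {n : ℕ} (K : Submodule (ZMod 2) (Fin n → ZMod 2)) (d : ℕ) : Prop :=
  IsLeast {w : ℕ | ∃ c ∈ K, c ≠ 0 ∧ hammingNorm c = w} d

/-- `u = 2^(m-4) (2^m - 1) / 5`. -/
def uConst (m : ℕ) : ℚ := 2 ^ (m - 4) * (2 ^ m - 1) / 5

/-- `v = 2^(m+2) (2^m - 1) / 5`. -/
def vConst (m : ℕ) : ℚ := 2 ^ (m + 2) * (2 ^ m - 1) / 5

/-- `w = 2 (3 · 2^(m-4) + 1) (2^m - 1)`. -/
def wConst (m : ℕ) : ℚ := 2 * (3 * 2 ^ (m - 4) + 1) * (2 ^ m - 1)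

/-- `E_0(k)`. -/
def E0 (m k : ℕ) : ℚ :=
  (1 + (-1) ^ k) / 2 * (-1) ^ (k / 2) * ((2 ^ (m - 1)).choose (k / 2) : ℚ)

/-- The sum over `0 ≤ i ≤ a`, `0 ≤ j ≤ b`, `i + j = k` of
`((-1)^i + (-1)^j) * binom(a, i) * binom(b, j)`. -/
def binomSum (a b k : ℕ) : ℚ :=
  ∑ p ∈ (Finset.Icc 0 a ×ˢ Finset.Icc 0 b).filter (fun p => p.1 + p.2 = k),
    ((-1) ^ p.1 + (-1) ^ p.2) * (a.choose p.1 : ℚ) * (b.choose p.2 : ℚ)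

/-- `E_1(k)`; the subtraction is exact for `m ≥ 4`. -/
def E1 (m k : ℕ) : ℚ :=
  binomSum (2 ^ (m - 1) - 2 ^ ((m + 2) / 2)) (2 ^ (m - 1) + 2 ^ ((m + 2) / 2)) k

/-- `E_2(k)`; the subtraction is exact for `m ≥ 2`. -/
def E2 (m k : ℕ) : ℚ :=
  binomSum (2 ^ (m - 1) - 2 ^ ((m - 2) / 2)) (2 ^ (m - 1) + 2 ^ ((m - 2) / 2)) k

end BinaryCode

end

/-! Index the coordinates by the points of `F`: powers of `α`, then `0` for the parity position. The
extended code is then cut out by the checks `∑ c = 0`, `∑ c x = 0` and `∑ c x^(1+2^e) = 0`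
(`mem_extendedCode_codeE_iff`). The MacWilliams identity (`macWilliams`) expresses its weight
distribution through the sign vectors `x ↦ ±ψ(ax + bx^(1+2^e))`, where `ψ` is the sign of the trace.
The contribution of a pair of opposite vectors depends only on the square of `S(a,b) = ∑ ψ(ax +
bx^(1+2^e))` (`coeff_prod_sign_add`), so it suffices to know how often each value of `S²` occurs.

As the sum of a quadratic form, `S²` is `0` or `2^m` times the size of the radical of `b`. For `b ≠
0` this size is 1 or 16 because `gcd(m, 2e) = 4`. Counting pairs `(b, z)` with `z` a nonzero radical
element, using `gcd(m, e) = 2`, shows that size 16 occurs for exactly `(2^m-1)/5` values of `b`.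
Parseval's identity then counts the `a` with `S ≠ 0`.

The dimension comes from the degrees of two coprime minimal polynomials. Both are `m`, except that
for `m = 4` the second belongs to `α^5`, a primitive cube root of unity, and has degree 2. For the
distance, the first two checks exclude weights 1, 2, 3, and the indicator of the subfield of order 4
is a codeword. -/

namespace BinaryCode

/-! ### Exponential sums of quadratic functions in characteristic two. -/

section CharacterSums

variable {F : Type*} [Field F]

/-- There is a primitive rational-valued additive character of a finite field of characteristic two
that is invariant under the Frobenius map: the sign of the absolute trace. -/
theorem exists_frobenius_invariant_addChar [Finite F] [Algebra (ZMod 2) F] :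
    ∃ ψ : AddChar F ℚ, ψ.IsPrimitive ∧ ∀ x, ψ (x ^ 2) = ψ x := by
  let σ : AddChar (ZMod 2) ℚ := AddChar.zmodChar 2 (ζ := (-1 : ℚ)) (by norm_num)
  refine ⟨σ.compAddMonoidHom (Algebra.trace (ZMod 2) F).toAddMonoidHom, ?_, ?_⟩
  · apply AddChar.IsPrimitive.of_ne_one
    rw [AddChar.ne_one_iff]
    obtain ⟨b, hb⟩ : ∃ b, Algebra.trace (ZMod 2) F b ≠ 0 := by
      by_contra! h
      exact Algebra.trace_ne_zero (ZMod 2) F (LinearMap.ext h)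
    refine ⟨b, ?_⟩
    have hb1 : Algebra.trace (ZMod 2) F b = 1 := by
      generalize Algebra.trace (ZMod 2) F b = t at hb
      revert t
      decide
    simp only [AddChar.compAddMonoidHom_apply, LinearMap.toAddMonoidHom_coe, hb1]
    rw [AddChar.zmodChar_apply]
    norm_num [ZMod.val_one]
  · intro x
    have h := Algebra.trace_eq_of_algEquiv
      (FiniteField.frobeniusAlgEquivOfAlgebraic (ZMod 2) F) x
    rw [FiniteField.coe_frobeniusAlgEquivOfAlgebraic] at h
    simp only [ZMod.card] at h
    simp only [AddChar.compAddMonoidHom_apply, LinearMap.toAddMonoidHom_coe, h]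

theorem addChar_pow_two_pow {ψ : AddChar F ℚ} (hψ : ∀ x, ψ (x ^ 2) = ψ x) (e : ℕ) (x : F) :
    ψ (x ^ 2 ^ e) = ψ x := by
  induction e with
  | zero => simp
  | succ e ih => rw [pow_succ, pow_mul, hψ, ih]

theorem addChar_sq_eq_one [CharP F 2] (ψ : AddChar F ℚ) (x : F) : ψ x ^ 2 = 1 := by
  rw [sq, ← AddChar.map_add_eq_mul, CharTwo.add_self_eq_zero, AddChar.map_zero_eq_one]

theorem addChar_eq_one_or [CharP F 2] (ψ : AddChar F ℚ) (x : F) : ψ x = 1 ∨ ψ x = -1 :=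
  sq_eq_one_iff.mp (addChar_sq_eq_one ψ x)

/-- The cross terms are `b x z^(2^e) + b z x^(2^e)`. Frobenius invariance allows the first to be
raised to the power `2^e`, after which `x^(2^e)` factors out. -/
theorem addChar_quad_add [CharP F 2] {ψ : AddChar F ℚ} (hfrob : ∀ x, ψ (x ^ 2) = ψ x) (e : ℕ)
    (a b x z : F) :
    ψ (a * (x + z) + b * (x + z) ^ (1 + 2 ^ e)) =
      ψ (a * x + b * x ^ (1 + 2 ^ e)) * ψ (a * z + b * z ^ (1 + 2 ^ e)) *
        ψ (x ^ 2 ^ e * (b ^ 2 ^ e * z ^ 2 ^ (2 * e) + b * z)) := by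
  have h1 : ψ (x ^ 2 ^ e * (b ^ 2 ^ e * z ^ 2 ^ (2 * e) + b * z)) =
      ψ (b * x * z ^ 2 ^ e + b * z * x ^ 2 ^ e) := by
    rw [mul_add, AddChar.map_add_eq_mul, AddChar.map_add_eq_mul,
      ← addChar_pow_two_pow hfrob e (b * x * z ^ 2 ^ e)]
    congr 2
    · rw [mul_pow, mul_pow, ← pow_mul, ← pow_add, two_mul]; ring
    · ring
  rw [h1, ← AddChar.map_add_eq_mul, ← AddChar.map_add_eq_mul]
  congr 1
  rw [pow_add, pow_add, pow_add, add_pow_char_pow]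
  ring

variable [Fintype F]

/-- The exponential sum of the quadratic function `x ↦ a x + b x ^ (1 + 2 ^ e)`. -/
def quadSum (ψ : AddChar F ℚ) (e : ℕ) (a b : F) : ℚ :=
  ∑ x, ψ (a * x + b * x ^ (1 + 2 ^ e))

theorem quadSum_zero_zero (ψ : AddChar F ℚ) (e : ℕ) : quadSum ψ e 0 0 = Fintype.card F := by
  simp [quadSum]

variable [DecidableEq F]

/-- The radical of the quadratic form attached to `x ↦ b x ^ (1 + 2 ^ e)`. -/
def quadRadical (e : ℕ) (b : F) : Finset F :=
  Finset.univ.filter fun z => b ^ 2 ^ e * z ^ 2 ^ (2 * e) + b * z = 0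

theorem mem_quadRadical {e : ℕ} {b z : F} :
    z ∈ quadRadical e b ↔ b ^ 2 ^ e * z ^ 2 ^ (2 * e) + b * z = 0 := by
  simp [quadRadical]

theorem zero_mem_quadRadical (e : ℕ) (b : F) : (0 : F) ∈ quadRadical e b := by
  simp [mem_quadRadical]

theorem add_mem_quadRadical [CharP F 2] {e : ℕ} {b y z : F} (hy : y ∈ quadRadical e b)
    (hz : z ∈ quadRadical e b) : y + z ∈ quadRadical e b := by
  rw [mem_quadRadical] at *
  rw [add_pow_char_pow]
  linear_combination hy + hz

/-- Write the second variable of the double sum as `x + z`. Since `x ↦ x^(2^e)` is a bijection, the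
sum over `x` is a complete character sum, which vanishes unless `z` lies in the radical. -/
theorem quadSum_sq [CharP F 2] {ψ : AddChar F ℚ} (hψ : ψ.IsPrimitive)
    (hfrob : ∀ x, ψ (x ^ 2) = ψ x) (e : ℕ) (a b : F) :
    quadSum ψ e a b ^ 2 =
      Fintype.card F * ∑ z ∈ quadRadical e b, ψ (a * z + b * z ^ (1 + 2 ^ e)) := by
  have hbij : Function.Bijective fun x : F => x ^ 2 ^ e := by
    have := (iterateFrobenius_inj F 2 e)
    rw [← Finite.injective_iff_bijective]
    intro x y h
    exact this (by simpa [iterateFrobenius_def] using h)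
  calc quadSum ψ e a b ^ 2
      = ∑ x, ∑ z, ψ (a * x + b * x ^ (1 + 2 ^ e)) * 
          ψ (a * (x + z) + b * (x + z) ^ (1 + 2 ^ e)) := by
        rw [sq, quadSum, Finset.sum_mul]
        refine Finset.sum_congr rfl fun x _ => ?_
        rw [Finset.mul_sum]
        exact (Equiv.sum_comp (Equiv.addLeft x)
          (fun y => ψ (a * x + b * x ^ (1 + 2 ^ e)) * ψ (a * y + b * y ^ (1 + 2 ^ e)))).symm
    _ = ∑ z, ψ (a * z + b * z ^ (1 + 2 ^ e)) *
          ∑ x : F, ψ (x ^ 2 ^ e * (b ^ 2 ^ e * z ^ 2 ^ (2 * e) + b * z)) := by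
        rw [Finset.sum_comm]
        refine Finset.sum_congr rfl fun z _ => ?_
        rw [Finset.mul_sum]
        refine Finset.sum_congr rfl fun x _ => ?_
        rw [addChar_quad_add hfrob]
        linear_combination (ψ (a * z + b * z ^ (1 + 2 ^ e)) *
          ψ (x ^ 2 ^ e * (b ^ 2 ^ e * z ^ 2 ^ (2 * e) + b * z))) *
          addChar_sq_eq_one ψ (a * x + b * x ^ (1 + 2 ^ e))
    _ = ∑ z, if b ^ 2 ^ e * z ^ 2 ^ (2 * e) + b * z = 0 then
          (Fintype.card F : ℚ) * ψ (a * z + b * z ^ (1 + 2 ^ e)) else 0 := by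
        refine Finset.sum_congr rfl fun z _ => ?_
        rw [hbij.sum_comp (fun y => ψ (y * (b ^ 2 ^ e * z ^ 2 ^ (2 * e) + b * z))),
          AddChar.sum_mulShift _ hψ]
        split_ifs <;> simp [mul_comm]
    _ = _ := by rw [quadRadical, Finset.mul_sum, Finset.sum_filter]

/-- On the radical the cross term is trivial, so the summand is a character of an additive group:
either constantly 1, or cancelled by translation by an element `y` of value `-1`. -/
theorem quadSum_sq_eq_zero_or [CharP F 2] {ψ : AddChar F ℚ} (hψ : ψ.IsPrimitive)
    (hfrob : ∀ x, ψ (x ^ 2) = ψ x) (e : ℕ) (a b : F) :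
    quadSum ψ e a b ^ 2 = 0 ∨
      quadSum ψ e a b ^ 2 = Fintype.card F * (quadRadical e b).card := by
  rw [quadSum_sq hψ hfrob]
  by_cases h : ∀ z ∈ quadRadical e b, ψ (a * z + b * z ^ (1 + 2 ^ e)) = 1
  · right
    rw [Finset.sum_congr rfl h]
    simp
  · left
    push Not at h
    obtain ⟨y, hy, hy1⟩ := h
    have hy2 := (addChar_eq_one_or ψ _).resolve_left hy1
    have key : ∑ z ∈ quadRadical e b, ψ (a * z + b * z ^ (1 + 2 ^ e)) =
        ∑ z ∈ quadRadical e b, -ψ (a * z + b * z ^ (1 + 2 ^ e)) := by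
      refine Finset.sum_nbij' (· + y) (· + y) (fun z hz => add_mem_quadRadical hz hy)
        (fun z hz => add_mem_quadRadical hz hy) ?_ ?_ ?_
      · intro z _; rw [add_assoc, CharTwo.add_self_eq_zero, add_zero]
      · intro z _; rw [add_assoc, CharTwo.add_self_eq_zero, add_zero]
      · intro z hz
        rw [addChar_quad_add hfrob, mem_quadRadical.mp hy, mul_zero, AddChar.map_zero_eq_one, hy2]
        ring
    rw [Finset.sum_neg_distrib] at key
    rw [self_eq_neg.mp key, mul_zero]

/-- Parseval's identity: summing over `a` leaves only `z = 0` in `quadSum_sq`. -/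
theorem sum_quadSum_sq [CharP F 2] {ψ : AddChar F ℚ} (hψ : ψ.IsPrimitive)
    (hfrob : ∀ x, ψ (x ^ 2) = ψ x) (e : ℕ) (b : F) :
    ∑ a, quadSum ψ e a b ^ 2 = (Fintype.card F : ℚ) ^ 2 := by
  simp_rw [quadSum_sq hψ hfrob, ← Finset.mul_sum]
  rw [Finset.sum_comm]
  simp_rw [AddChar.map_add_eq_mul, ← Finset.sum_mul]
  simp_rw [AddChar.sum_mulShift _ hψ]
  rw [Finset.sum_eq_single_of_mem 0 (zero_mem_quadRadical e b)]
  · simp [sq]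
  · intro z _ hz
    simp [hz]

theorem quadSum_zero_right {ψ : AddChar F ℚ} (hψ : ψ.IsPrimitive) (e : ℕ) {a : F} (ha : a ≠ 0) :
    quadSum ψ e a 0 = 0 := by
  have h := AddChar.sum_mulShift a hψ
  simpa [quadSum, ha, mul_comm] using h

theorem quadSum_sq_of_card_radical_eq_one [CharP F 2] {ψ : AddChar F ℚ} (hψ : ψ.IsPrimitive)
    (hfrob : ∀ x, ψ (x ^ 2) = ψ x) {e : ℕ} {b : F} (hb : (quadRadical e b).card = 1) (a : F) :
    quadSum ψ e a b ^ 2 = Fintype.card F := by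
  obtain ⟨z, hz⟩ := Finset.card_eq_one.mp hb
  have h0 := zero_mem_quadRadical e b
  rw [hz, Finset.mem_singleton] at h0
  rw [quadSum_sq hψ hfrob, hz, ← h0]
  simp

/-- The number of `a` for which the exponential sum does not vanish. -/
theorem card_quadSum_ne_zero [CharP F 2] {ψ : AddChar F ℚ} (hψ : ψ.IsPrimitive)
    (hfrob : ∀ x, ψ (x ^ 2) = ψ x) (e : ℕ) (b : F) :
    ((Finset.univ.filter fun a => quadSum ψ e a b ≠ 0).card : ℚ) * (quadRadical e b).card =
      Fintype.card F := by
  have h := sum_quadSum_sq hψ hfrob e b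
  have h2 : ∀ a, quadSum ψ e a b ^ 2 = if quadSum ψ e a b ≠ 0 then
      (Fintype.card F : ℚ) * (quadRadical e b).card else 0 := by
    intro a
    split_ifs with ha
    · exact (quadSum_sq_eq_zero_or hψ hfrob e a b).resolve_left (pow_ne_zero 2 ha)
    · rw [not_not.mp ha]; norm_num
  simp_rw [h2] at h
  rw [← Finset.sum_filter, Finset.sum_const, nsmul_eq_mul] at h
  have hq : (Fintype.card F : ℚ) ≠ 0 := by exact_mod_cast Fintype.card_ne_zero
  apply mul_left_cancel₀ hq
  linear_combination h

end CharacterSums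

/-! ### Sizes of the radicals. -/

section RadicalCount

theorem gcd_two_mul_eq_four {m e : ℕ} (hm : m % 4 = 0) (hgcd : Nat.gcd m e = 2) :
    Nat.gcd m (2 * e) = 4 := by
  obtain ⟨r, rfl⟩ : ∃ r, m = 2 * r := ⟨m / 2, by omega⟩
  obtain ⟨s, rfl⟩ : 2 ∣ e := hgcd ▸ Nat.gcd_dvd_right (2 * r) e
  rw [Nat.gcd_mul_left] at hgcd ⊢
  obtain ⟨t, rfl⟩ : ∃ t, r = 2 * t := ⟨r / 2, by omega⟩
  rw [Nat.gcd_mul_left]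
  have h1 : Nat.gcd (2 * t) s = 1 := by omega
  have h2 : Nat.gcd t s = 1 := Nat.Coprime.coprime_mul_left h1
  omega

variable {F : Type*} [Field F] [Fintype F] [DecidableEq F]

theorem card_units_pow_two_pow_sub_one {m : ℕ} (hF : Fintype.card F = 2 ^ m) (k : ℕ) :
    (Finset.univ.filter fun x : Fˣ => x ^ (2 ^ k - 1) = 1).card = 2 ^ Nat.gcd m k - 1 := by
  have h := IsCyclic.card_powMonoidHom_ker (G := Fˣ) (2 ^ k - 1)
  rw [Nat.card_eq_fintype_card, Nat.card_eq_fintype_card, Fintype.card_units, hF,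
    Nat.pow_sub_one_gcd_pow_sub_one] at h
  rw [← h, Fintype.card_subtype]
  simp [MonoidHom.mem_ker]

/-- Divide the radical equation by `b z` and use `2^(2e) - 1 = (1 + 2^e)(2^e - 1)`. -/
theorem units_mem_quadRadical_iff [CharP F 2] (e : ℕ) (b z : Fˣ) :
    (z : F) ∈ quadRadical e (b : F) ↔ (b * z ^ (1 + 2 ^ e)) ^ (2 ^ e - 1) = 1 := by
  rw [mem_quadRadical, ← CharTwo.sub_eq_add, sub_eq_zero]
  have h : (b * z ^ (1 + 2 ^ e)) ^ (2 ^ e - 1) * (b * z) = b ^ 2 ^ e * z ^ 2 ^ (2 * e) := by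
    obtain ⟨k, hk⟩ : ∃ k, 2 ^ e = k + 1 := ⟨2 ^ e - 1, by have := Nat.two_pow_pos e; omega⟩
    rw [two_mul, pow_add 2 e e, hk, Nat.add_sub_cancel]
    rw [mul_pow, ← pow_mul]
    have : (k + 1) * (k + 1) = (1 + (k + 1)) * k + 1 := by ring
    rw [this]
    simp only [pow_succ]
    exact mul_mul_mul_comm _ _ _ _
  rw [← Units.val_pow_eq_pow_val, ← Units.val_pow_eq_pow_val, ← Units.val_mul, ← Units.val_mul,
    Units.val_inj, ← h, mul_eq_right]

theorem card_eq_card_units_add_one {s : Finset F} (hs : 0 ∈ s) :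
    s.card = (Finset.univ.filter fun z : Fˣ => (z : F) ∈ s).card + 1 := by
  rw [← Finset.card_erase_add_one hs]
  congr 1
  symm
  refine Finset.card_bij (fun z _ => (z : F)) ?_ ?_ ?_
  · intro z hz
    simpa using hz
  · intro z _ w _ h
    exact Units.ext h
  · intro z hz
    rw [Finset.mem_erase] at hz
    exact ⟨Units.mk0 z hz.1, by simpa using hz.2, rfl⟩

/-- The nonzero radical elements, if any, form a coset of the group of solutions of `x^(2^(2e)-1) =
1`, which has order `2^gcd(m,2e) - 1 = 15`. -/
theorem card_quadRadical_eq_one_or [CharP F 2] {m e : ℕ} (hF : Fintype.card F = 2 ^ m)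
    (hg : Nat.gcd m (2 * e) = 4) (b : Fˣ) :
    (quadRadical e (b : F)).card = 1 ∨ (quadRadical e (b : F)).card = 16 := by
  rw [card_eq_card_units_add_one (zero_mem_quadRadical e (b : F))]
  simp_rw [units_mem_quadRadical_iff]
  rcases Finset.eq_empty_or_nonempty
    (Finset.univ.filter fun z : Fˣ => (b * z ^ (1 + 2 ^ e)) ^ (2 ^ e - 1) = 1) with h | ⟨w, hw⟩
  · left; rw [h]; rfl
  · right
    have h15 := card_units_pow_two_pow_sub_one hF (2 * e)
    rw [hg] at h15
    have hexp : (2 ^ (2 * e) - 1) = (1 + 2 ^ e) * (2 ^ e - 1) := by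
      rw [mul_comm 2 e, pow_mul, add_comm 1]
      exact Nat.sq_sub_sq (2 ^ e) 1
    suffices (Finset.univ.filter fun z : Fˣ => (b * z ^ (1 + 2 ^ e)) ^ (2 ^ e - 1) = 1).card =
        (Finset.univ.filter fun x : Fˣ => x ^ (2 ^ (2 * e) - 1) = 1).card by
      rw [this, h15]
      norm_num
    rw [Finset.mem_filter] at hw
    refine Finset.card_bij' (fun z _ => w⁻¹ * z) (fun x _ => w * x) ?_ ?_ ?_ ?_
    · intro z hz
      rw [Finset.mem_filter] at hz ⊢
      refine ⟨Finset.mem_univ _, ?_⟩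
      have := hz.2.trans hw.2.symm
      rw [mul_pow, mul_pow b, mul_right_inj, ← pow_mul, ← pow_mul, ← hexp] at this
      rw [mul_pow, inv_pow, this, inv_mul_cancel]
    · intro x hx
      rw [Finset.mem_filter] at hx ⊢
      refine ⟨Finset.mem_univ _, ?_⟩
      rw [mul_pow w, ← mul_assoc, mul_pow _ (x ^ _), hw.2, ← pow_mul, ← hexp, hx.2, one_mul]
    · intro z _; simp
    · intro z _; simp

/-- Double counting: for fixed `z`, the translation `b ↦ b z^(1+2^e)` identifies the admissible `b`
with the solutions of `b^(2^e-1) = 1`, of which there are `2^gcd(m,e) - 1 = 3`. -/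
theorem sum_card_units_quadRadical [CharP F 2] {m e : ℕ} (hF : Fintype.card F = 2 ^ m)
    (hg : Nat.gcd m e = 2) :
    ∑ b : Fˣ, (Finset.univ.filter fun z : Fˣ => (z : F) ∈ quadRadical e (b : F)).card =
      3 * (2 ^ m - 1) := by
  simp_rw [units_mem_quadRadical_iff, Finset.card_filter]
  rw [Finset.sum_comm]
  have h3 := card_units_pow_two_pow_sub_one hF e
  rw [hg, Finset.card_filter] at h3
  have : ∀ z : Fˣ, ∑ b : Fˣ, (if (b * z ^ (1 + 2 ^ e)) ^ (2 ^ e - 1) = 1 then 1 else 0) = 3 := by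
    intro z
    exact (Equiv.sum_comp (Equiv.mulRight (z ^ (1 + 2 ^ e)))
      (fun b : Fˣ => if b ^ (2 ^ e - 1) = 1 then 1 else 0)).trans h3
  simp_rw [this]
  rw [Finset.sum_const, Finset.card_univ, Fintype.card_units, hF, smul_eq_mul, mul_comm]

/-- The number of nonzero `b` whose quadratic form is degenerate. -/
theorem five_mul_card_degenerate [CharP F 2] {m e : ℕ} (hF : Fintype.card F = 2 ^ m)
    (hm : m % 4 = 0) (hg : Nat.gcd m e = 2) :
    5 * (Finset.univ.filter fun b : Fˣ => (quadRadical e (b : F)).card = 16).card = 2 ^ m - 1 := by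
  have h := sum_card_units_quadRadical hF hg
  have h2 : ∀ b : Fˣ, (Finset.univ.filter fun z : Fˣ => (z : F) ∈ quadRadical e (b : F)).card =
      if (quadRadical e (b : F)).card = 16 then 15 else 0 := by
    intro b
    have h1 := card_eq_card_units_add_one (zero_mem_quadRadical e (b : F))
    have h2 := card_quadRadical_eq_one_or hF (gcd_two_mul_eq_four hm hg) b
    split_ifs <;> omega
  -- Each degenerate `b` contributes 15 and every other `b` contributes 0, so 15 times the count
  -- equals `3(2^m - 1)`.
  simp_rw [h2] at h
  rw [← Finset.sum_filter, Finset.sum_const, smul_eq_mul] at h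
  omega

end RadicalCount

/-! ### Weight enumerators and the MacWilliams identity. -/

section WeightEnumerator

theorem coeff_one_sub_X_pow (n k : ℕ) :
    ((1 - X : ℚ[X]) ^ n).coeff k = (-1) ^ k * (n.choose k : ℚ) := by
  have h : (1 - X : ℚ[X]) ^ n = ((1 + X : ℚ[X]) ^ n).comp (C (-1) * X) := by
    simp [sub_eq_add_neg]
  rw [h, comp_C_mul_X_coeff, coeff_one_add_X_pow, mul_comm]

theorem binomSum_eq_coeff (a b k : ℕ) :
    binomSum a b k =
      ((1 - X : ℚ[X]) ^ a * (1 + X) ^ b + (1 + X) ^ a * (1 - X) ^ b).coeff k := by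
  rw [coeff_add, coeff_mul, coeff_mul, ← Finset.sum_add_distrib, binomSum]
  simp_rw [coeff_one_sub_X_pow, coeff_one_add_X_pow]
  refine Finset.sum_subset_zero_on_sdiff ?_ ?_ ?_
  · intro p hp
    rw [Finset.mem_filter] at hp
    exact Finset.HasAntidiagonal.mem_antidiagonal.mpr hp.2
  · intro p hp
    rw [Finset.mem_sdiff, Finset.HasAntidiagonal.mem_antidiagonal, Finset.mem_filter, Finset.mem_product,
      Finset.mem_Icc, Finset.mem_Icc] at hp
    have h : a < p.1 ∨ b < p.2 := by
      by_contra! h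
      exact hp.2 ⟨⟨⟨Nat.zero_le _, h.1⟩, Nat.zero_le _, h.2⟩, hp.1⟩
    rcases h with h | h <;> simp [Nat.choose_eq_zero_of_lt h]
  · intro p _
    ring

/-- This is the case `S = 0`, where the generating function collapses to `2(1 - X²)^n`. -/
theorem binomSum_self (n k : ℕ) :
    binomSum n n k = (1 + (-1) ^ k) * (-1) ^ (k / 2) * (n.choose (k / 2) : ℚ) := by
  have h : (1 - X : ℚ[X]) ^ n * (1 + X) ^ n + (1 + X) ^ n * (1 - X) ^ n =
      C 2 * expand ℚ 2 ((1 - X) ^ n) := by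
    rw [map_pow, map_sub, map_one, expand_X, ← mul_pow, ← mul_pow, map_ofNat]
    rw [show (1 - X : ℚ[X]) * (1 + X) = 1 - X ^ 2 by ring,
      show (1 + X : ℚ[X]) * (1 - X) = 1 - X ^ 2 by ring]
    ring
  rw [binomSum_eq_coeff, h, coeff_C_mul, coeff_expand two_pos, coeff_one_sub_X_pow]
  split_ifs with hk
  · rw [(even_iff_two_dvd.mpr hk).neg_one_pow]; ring
  · rw [(Nat.not_even_iff_odd.mp (mt even_iff_two_dvd.mp hk)).neg_one_pow]; ring

theorem binomSum_zero_left (n k : ℕ) :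
    binomSum 0 n k = (1 + (-1) ^ k) * (n.choose k : ℚ) := by
  rw [binomSum_eq_coeff, pow_zero, pow_zero, one_mul, one_mul, coeff_add, coeff_one_sub_X_pow,
    coeff_one_add_X_pow]
  ring

/-- Product of the factors `1 ± X` with given signs. -/
theorem prod_one_add_sign {ι : Type*} [Fintype ι] (ε : ι → ℚ) (hε : ∀ i, ε i = 1 ∨ ε i = -1) :
    ∏ i, (1 + C (ε i) * X : ℚ[X]) =
      (1 + X) ^ (Finset.univ.filter fun i => ε i = 1).card *
        (1 - X) ^ (Finset.univ.filter fun i => ¬ ε i = 1).card := by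
  rw [← Finset.prod_filter_mul_prod_filter_not Finset.univ (fun i => ε i = 1)]
  congr 1
  · refine Finset.prod_eq_pow_card fun i hi => ?_
    rw [(Finset.mem_filter.mp hi).2, C_1, one_mul]
  · refine Finset.prod_eq_pow_card fun i hi => ?_
    rw [(hε i).resolve_left (Finset.mem_filter.mp hi).2, C_neg, C_1]
    ring

/-- The sum of the signs fixes how many are `+1` and how many `-1`, namely `h ± t` in some order.
Adding the opposite vector makes the order irrelevant, so the square of the sum suffices. -/
theorem coeff_prod_sign_add {ι : Type*} [Fintype ι] (ε : ι → ℚ) (hε : ∀ i, ε i = 1 ∨ ε i = -1)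
    {h t : ℕ} (hcard : Fintype.card ι = 2 * h) (ht : t ≤ h)
    (hsum : (∑ i, ε i) ^ 2 = (2 * t : ℚ) ^ 2) (k : ℕ) :
    (∏ i, (1 + C (ε i) * X : ℚ[X]) + ∏ i, (1 + C (-ε i) * X : ℚ[X])).coeff k =
      binomSum (h - t) (h + t) k := by
  have hneg : ∏ i, (1 + C (-ε i) * X : ℚ[X]) =
      (1 - X) ^ (Finset.univ.filter fun i => ε i = 1).card *
        (1 + X) ^ (Finset.univ.filter fun i => ¬ ε i = 1).card := by
    have h1 : ∏ i, (1 + C (-ε i) * X : ℚ[X]) =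
        (∏ i, (1 + C (ε i) * X : ℚ[X])).comp (C (-1) * X) := by
      rw [prod_comp]
      refine Finset.prod_congr rfl fun i _ => ?_
      simp
    rw [h1, prod_one_add_sign ε hε]
    simp [sub_eq_add_neg]
  rw [hneg, prod_one_add_sign ε hε, binomSum_eq_coeff]
  have hN := Finset.card_filter_add_card_filter_not (s := (Finset.univ : Finset ι))
    (fun i => ε i = 1)
  rw [Finset.card_univ, hcard] at hN
  have hS : ∑ i, ε i = ((Finset.univ.filter fun i => ε i = 1).card : ℚ) -
      (Finset.univ.filter fun i => ¬ ε i = 1).card := by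
    rw [← Finset.sum_filter_add_sum_filter_not Finset.univ (fun i => ε i = 1),
      Finset.sum_congr rfl (fun i hi => (Finset.mem_filter.mp hi).2),
      Finset.sum_congr (s₁ := Finset.univ.filter fun i => ¬ ε i = 1) rfl
        (fun i hi => (hε i).resolve_left (Finset.mem_filter.mp hi).2)]
    simp [sub_eq_add_neg]
  generalize (Finset.univ.filter fun i => ε i = 1).card = M at *
  generalize (Finset.univ.filter fun i => ¬ ε i = 1).card = N at *
  rw [hS] at hsum
  rcases sq_eq_sq_iff_eq_or_eq_neg.mp hsum with h1 | h1
  · have h2 : M = N + 2 * t := by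
      have : (M : ℚ) = N + 2 * t := by linarith
      exact_mod_cast this
    obtain rfl : M = h + t := by omega
    obtain rfl : N = h - t := by omega
    congr 1
    ring
  · have h2 : N = M + 2 * t := by
      have : (N : ℚ) = M + 2 * t := by linarith
      exact_mod_cast this
    obtain rfl : N = h + t := by omega
    obtain rfl : M = h - t := by omega
    congr 1
    ring

/-- The weight-`k` part of the sum of a multiplicative character over all binary words. -/
theorem sum_words_prod {ι : Type*} [Fintype ι] [DecidableEq ι] (ε : ι → ℚ) (k : ℕ) :
    ∑ c : ι → ZMod 2 with hammingNorm c = k, ∏ i, (if c i = 0 then 1 else ε i) =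
      (∏ i, (1 + C (ε i) * X : ℚ[X])).coeff k := by
  have h : ∏ i, (1 + C (ε i) * X : ℚ[X]) =
      ∑ c : ι → ZMod 2, C (∏ i, (if c i = 0 then 1 else ε i)) * X ^ hammingNorm c := by
    have h1 : ∀ i, (1 + C (ε i) * X : ℚ[X]) =
        ∑ j : ZMod 2, if j = 0 then 1 else C (ε i) * X := by
      intro i
      exact (Fin.sum_univ_two (fun j : Fin 2 => if j = 0 then (1 : ℚ[X]) else C (ε i) * X)).symm
    simp_rw [h1]
    rw [Fintype.prod_sum]
    refine Finset.sum_congr rfl fun c _ => ?_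
    rw [hammingNorm, ← Finset.prod_const, Finset.prod_filter, map_prod, ← Finset.prod_mul_distrib]
    refine Finset.prod_congr rfl fun i _ => ?_
    by_cases hc : c i = 0 <;> simp [hc]
  rw [h, finsetSum_coeff, Finset.sum_filter]
  refine Finset.sum_congr rfl fun c _ => ?_
  rw [coeff_C_mul_X_pow]
  simp only [eq_comm]

theorem sum_eq_hammingNorm {ι : Type*} [Fintype ι] (c : ι → ZMod 2) :
    ∑ i, c i = (hammingNorm c : ZMod 2) := by
  rw [hammingNorm, Finset.card_filter, Nat.cast_sum]
  refine Finset.sum_congr rfl fun i _ => ?_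
  generalize c i = t
  revert t
  decide

theorem addChar_sum {A M ι : Type*} [AddCommMonoid A] [CommMonoid M] (ψ : AddChar A M)
    (s : Finset ι) (f : ι → A) : ψ (∑ i ∈ s, f i) = ∏ i ∈ s, ψ (f i) := by
  classical
  induction s using Finset.induction_on with
  | empty => simp
  | insert i s hi ih => rw [Finset.sum_insert hi, Finset.prod_insert hi, ψ.map_add_eq_mul, ih]

variable {F : Type*} [Field F] [Algebra (ZMod 2) F]

theorem addChar_syndrome {ι : Type*} [Fintype ι] (ψ : AddChar F ℚ) (u v : ι → F)
    (c : ι → ZMod 2) (a b : F) :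
    ψ (a * ∑ i, c i • u i + b * ∑ i, c i • v i) =
      ∏ i, (if c i = 0 then 1 else ψ (a * u i + b * v i)) := by
  rw [Finset.mul_sum, Finset.mul_sum, ← Finset.sum_add_distrib, addChar_sum]
  refine Finset.prod_congr rfl fun i _ => ?_
  have h : c i = 0 ∨ c i = 1 := by
    generalize c i = t
    revert t
    decide
  rcases h with h | h <;> simp [h]

variable [Fintype F] [DecidableEq F]

/-- The MacWilliams identity for the code with parity checks `1`, `u`, `v`. -/
theorem macWilliams {ι : Type*} [Fintype ι] [DecidableEq ι] {ψ : AddChar F ℚ}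
    (hψ : ψ.IsPrimitive) (u v : ι → F) (k : ℕ) :
    2 * (Fintype.card F : ℚ) ^ 2 *
      (Finset.univ.filter fun c : ι → ZMod 2 => hammingNorm c = k ∧
        (∑ i, c i = 0 ∧ ∑ i, c i • u i = 0 ∧ ∑ i, c i • v i = 0)).card =
      ∑ a, ∑ b, (∏ i, (1 + C (ψ (a * u i + b * v i)) * X : ℚ[X]) +
        ∏ i, (1 + C (-ψ (a * u i + b * v i)) * X : ℚ[X])).coeff k := by
  -- Negating all signs replaces `X` by `-X`. The two products together give the factor `1 +
  -- (-1)^k`, which imposes the parity check.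
  have hneg : ∀ a b, (∏ i, (1 + C (-ψ (a * u i + b * v i)) * X : ℚ[X])).coeff k =
      (∏ i, (1 + C (ψ (a * u i + b * v i)) * X : ℚ[X])).coeff k * (-1) ^ k := by
    intro a b
    rw [← comp_C_mul_X_coeff, prod_comp]
    congr 1
    refine Finset.prod_congr rfl fun i _ => ?_
    simp
  simp_rw [coeff_add, hneg, ← sum_words_prod, ← addChar_syndrome]
  have hcomm : ∀ a b, (∑ c : ι → ZMod 2 with hammingNorm c = k,
        ψ (a * ∑ i, c i • u i + b * ∑ i, c i • v i)) +
      (∑ c : ι → ZMod 2 with hammingNorm c = k,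
        ψ (a * ∑ i, c i • u i + b * ∑ i, c i • v i)) * (-1) ^ k =
      ∑ c : ι → ZMod 2 with hammingNorm c = k,
        (1 + (-1) ^ k) * (ψ (a * ∑ i, c i • u i) * ψ (b * ∑ i, c i • v i)) := by
    intro a b
    simp_rw [AddChar.map_add_eq_mul]
    rw [← Finset.mul_sum]
    ring
  simp_rw [hcomm]
  have hswap : ∀ (f : F → F → (ι → ZMod 2) → ℚ) (t : Finset (ι → ZMod 2)),
      ∑ a, ∑ b, ∑ c ∈ t, f a b c = ∑ c ∈ t, ∑ a, ∑ b, f a b c := fun f t =>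
    (Finset.sum_congr rfl fun a _ => Finset.sum_comm).trans Finset.sum_comm
  rw [hswap]
  simp_rw [← Finset.mul_sum, ← Finset.sum_mul]
  simp_rw [AddChar.sum_mulShift _ hψ]
  rw [← Finset.filter_filter, Finset.card_filter, Nat.cast_sum, Finset.mul_sum, Finset.mul_sum]
  refine Finset.sum_congr rfl fun c hc => ?_
  simp only [sum_eq_hammingNorm, (Finset.mem_filter.mp hc).2, ZMod.natCast_eq_zero_iff_even]
  by_cases hk : Even k
  · by_cases h1 : ∑ i, c i • u i = 0 <;> by_cases h2 : ∑ i, c i • v i = 0 <;>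
      simp [hk, h1, h2, hk.neg_one_pow]
    ring
  · have hk' := Nat.not_even_iff_odd.mp hk
    simp [hk, hk'.neg_one_pow]

end WeightEnumerator

/-! ### Cyclic codes and their extensions. -/

section CyclicCodes

theorem mem_cyclicCode_iff {n : ℕ} {g : (ZMod 2)[X]} (hg : g ∣ X ^ n - 1) (c : Fin n → ZMod 2) :
    c ∈ cyclicCode n g ↔ g ∣ ∑ i : Fin n, C (c i) * X ^ (i : ℕ) := by
  change Ideal.Quotient.mk _ (∑ i : Fin n, C (c i) * X ^ (i : ℕ)) ∈
    Ideal.span {Ideal.Quotient.mk (Ideal.span {(X ^ n - 1 : (ZMod 2)[X])}) g} ↔ _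
  rw [Ideal.mem_span_singleton]
  constructor
  · rintro ⟨h, hh⟩
    obtain ⟨h, rfl⟩ := Ideal.Quotient.mk_surjective h
    rw [← map_mul, Ideal.Quotient.eq, Ideal.mem_span_singleton] at hh
    exact (dvd_iff_dvd_of_dvd_sub (hg.trans hh)).mpr (dvd_mul_right _ _)
  · exact fun h => map_dvd _ h

/-- The code is the kernel of reduction from words to `𝔽₂[x]/(g)`. This map is onto because
remainders modulo `g` have fewer than `n + 1` coefficients to place, all in degrees below `deg g ≤
n`. -/
theorem finrank_cyclicCode_add_natDegree {n : ℕ} {g : (ZMod 2)[X]} (hgm : g.Monic)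
    (hn : g.natDegree ≤ n) (hg : g ∣ X ^ n - 1) :
    Module.finrank (ZMod 2) (cyclicCode n g) + g.natDegree = n := by
  let L := Fintype.linearCombination (ZMod 2) (fun i : Fin n => AdjoinRoot.root g ^ (i : ℕ))
  have hL : ∀ c, L c = AdjoinRoot.mk g (∑ i : Fin n, C (c i) * X ^ (i : ℕ)) := by
    intro c
    simp [L, Fintype.linearCombination_apply, Algebra.smul_def, AdjoinRoot.algebraMap_eq]
  have hker : LinearMap.ker L = cyclicCode n g := by
    ext c
    rw [LinearMap.mem_ker, hL, AdjoinRoot.mk_eq_zero, mem_cyclicCode_iff hg]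
  have hsurj : LinearMap.range L = ⊤ := by
    rw [LinearMap.range_eq_top]
    intro y
    obtain ⟨p, rfl⟩ := AdjoinRoot.mk_surjective y
    refine ⟨fun i => (p %ₘ g).coeff i, ?_⟩
    have hdeg : g.degree ≤ (n : WithBot ℕ) := degree_le_of_natDegree_le hn
    have h := sum_modByMonic_coeff (p := p) hgm hdeg
    simp_rw [← C_mul_X_pow_eq_monomial] at h
    rw [hL, h, AdjoinRoot.mk_eq_mk]
    rw [modByMonic_eq_sub_mul_div]
    exact ⟨-(p /ₘ g), by ring⟩
  have h := LinearMap.finrank_range_add_finrank_ker L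
  rw [hker, hsurj, finrank_top, (AdjoinRoot.powerBasis hgm.ne_zero).finrank,
    AdjoinRoot.powerBasis_dim, Module.finrank_fin_fun] at h
  omega

theorem extendWord_injective (n : ℕ) : Function.Injective (extendWord n) := by
  intro c d h
  funext i
  have := congrFun h i.castSucc
  simpa [extendWord] using this

theorem finrank_extendedCode {n : ℕ} (K : Submodule (ZMod 2) (Fin n → ZMod 2)) :
    Module.finrank (ZMod 2) (extendedCode K) = Module.finrank (ZMod 2) K :=
  (Submodule.equivMapOfInjective _ (extendWord_injective n) K).finrank_eq.symm

theorem mem_extendedCode_iff {n : ℕ} (K : Submodule (ZMod 2) (Fin n → ZMod 2))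
    (c : Fin (n + 1) → ZMod 2) :
    c ∈ extendedCode K ↔ (∑ i, c i = 0 ∧ (fun i : Fin n => c i.castSucc) ∈ K) := by
  constructor
  · rintro ⟨d, hd, rfl⟩
    refine ⟨?_, ?_⟩
    · rw [Fin.sum_univ_castSucc]
      simp [extendWord, CharTwo.add_self_eq_zero]
    · simpa [extendWord] using hd
  · rintro ⟨h0, hK⟩
    refine ⟨_, hK, ?_⟩
    funext i
    rw [Fin.sum_univ_castSucc, add_comm] at h0
    refine Fin.lastCases ?_ (fun j => ?_) i
    · simpa [extendWord] using (eq_neg_of_add_eq_zero_left h0).symm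
    · simp [extendWord]

end CyclicCodes

/-! ### Minimal polynomials of powers of a generator; dimension and parity checks. -/

section MinimalPolynomials

section

variable {F : Type*} [Field F] {m : ℕ} {α : Fˣ}

theorem orderOf_generator (hF : Nat.card F = 2 ^ m)
    (hα : ∀ x : Fˣ, x ∈ Subgroup.zpowers α) : orderOf α = 2 ^ m - 1 := by
  rw [orderOf_eq_card_of_forall_mem_zpowers hα, Nat.card_units, hF]

theorem generator_pow_eq_one_iff (hα : orderOf α = 2 ^ m - 1) (k : ℕ) :
    (α : F) ^ k = 1 ↔ 2 ^ m - 1 ∣ k := by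
  rw [← hα, orderOf_dvd_iff_pow_eq_one, ← Units.val_pow_eq_pow_val, Units.val_eq_one]

/-- The points of the field in the order of the coordinates of the extended code: the powers of
`α`, and then `0`. -/
def codePoint (m : ℕ) (α : F) : Fin (2 ^ m - 1 + 1) → F :=
  Fin.snoc (α := fun _ => F) (fun i : Fin (2 ^ m - 1) => α ^ (i : ℕ)) 0

theorem codePoint_bijective [Finite F] (hα : orderOf α = 2 ^ m - 1) (hF : Nat.card F = 2 ^ m) :
    Function.Bijective (codePoint m (α : F)) := by
  have := Fintype.ofFinite F
  rw [Fintype.bijective_iff_injective_and_card]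
  constructor
  · unfold codePoint
    rw [Fin.snoc_injective_iff]
    constructor
    · intro i j h
      have h' : α ^ (i : ℕ) = α ^ (j : ℕ) := Units.ext (by simpa using h)
      exact Fin.ext (pow_injOn_Iio_orderOf (by simp [hα, i.2]) (by simp [hα, j.2]) h')
    · rintro ⟨i, hi⟩
      exact pow_ne_zero _ α.ne_zero hi
  · rw [Fintype.card_fin, ← Nat.card_eq_fintype_card, hF]
    exact Nat.sub_add_cancel Nat.one_le_two_pow

end

variable {F : Type*} [Field F] [Algebra (ZMod 2) F]

theorem genPoly_singleton [Finite F] (α : F) (e : ℕ) :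
    genPoly α {e} = minpoly (ZMod 2) α * minpoly (ZMod 2) (α ^ (1 + 2 ^ e)) := by
  rw [genPoly, Finset.lcm_singleton,
    (minpoly.monic (Algebra.IsIntegral.isIntegral _)).normalize_eq_self]

theorem minpoly_dvd_X_pow_sub_one {x : F} {n : ℕ} (h : x ^ n = 1) :
    minpoly (ZMod 2) x ∣ X ^ n - 1 :=
  minpoly.dvd _ _ (by simp [h])

theorem minpoly_isCoprime [Finite F] {x y : F} {n : ℕ} (hx : x ^ n ≠ 1) (hy : y ^ n = 1) :
    IsCoprime (minpoly (ZMod 2) x) (minpoly (ZMod 2) y) := by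
  have hix := minpoly.irreducible (A := ZMod 2) (Algebra.IsIntegral.isIntegral x)
  rw [hix.coprime_iff_not_dvd]
  intro h
  have h1 := h.trans (minpoly_dvd_X_pow_sub_one hy)
  rw [minpoly.dvd_iff] at h1
  apply hx
  simpa [sub_eq_zero] using h1

/-- The field `𝔽₂(x)` has `2^d` elements, where `d` is the degree of `x`. -/
theorem pow_two_pow_natDegree_minpoly [Finite F] (x : F) :
    x ^ 2 ^ (minpoly (ZMod 2) x).natDegree = x := by
  have hx : IsIntegral (ZMod 2) x := Algebra.IsIntegral.isIntegral x
  let K := IntermediateField.adjoin (ZMod 2) {x}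
  have := Fintype.ofFinite K
  have hc := Module.card_eq_pow_finrank (K := ZMod 2) (V := K)
  rw [IntermediateField.adjoin.finrank hx, ZMod.card] at hc
  have h := FiniteField.pow_card (IntermediateField.AdjoinSimple.gen (ZMod 2) x : K)
  rw [hc] at h
  simpa using congrArg (algebraMap K F) h

theorem natDegree_minpoly_dvd [Finite F] {m : ℕ} (hF : Nat.card F = 2 ^ m) (x : F) :
    (minpoly (ZMod 2) x).natDegree ∣ m := by
  have h := minpoly.degree_dvd (K := ZMod 2) (Algebra.IsIntegral.isIntegral x)
  have hc := Module.natCard_eq_pow_finrank (K := ZMod 2) (V := F)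
  rw [hF, Nat.card_zmod] at hc
  rwa [← Nat.pow_right_injective le_rfl hc] at h

variable [Finite F] {m e : ℕ} {α : Fˣ}

theorem dvd_mul_two_pow_natDegree_minpoly (hα : orderOf α = 2 ^ m - 1) (s : ℕ) :
    2 ^ m - 1 ∣ s * (2 ^ (minpoly (ZMod 2) ((α : F) ^ s)).natDegree - 1) := by
  rw [← generator_pow_eq_one_iff hα, pow_mul]
  have h := pow_two_pow_natDegree_minpoly ((α : F) ^ s)
  rw [← Nat.sub_add_cancel (Nat.one_le_two_pow
    (n := (minpoly (ZMod 2) ((α : F) ^ s)).natDegree)), pow_succ] at h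
  rwa [mul_eq_right₀ (pow_ne_zero s α.ne_zero)] at h

theorem natDegree_minpoly_generator (hF : Nat.card F = 2 ^ m) (hm : 0 < m)
    (hα : orderOf α = 2 ^ m - 1) : (minpoly (ZMod 2) (α : F)).natDegree = m := by
  have h := dvd_mul_two_pow_natDegree_minpoly hα 1
  rw [one_mul, pow_one] at h
  have hpos := minpoly.natDegree_pos (A := ZMod 2) (Algebra.IsIntegral.isIntegral (α : F))
  have hle := Nat.le_of_dvd hm (natDegree_minpoly_dvd hF (α : F))
  have h1 := Nat.le_of_dvd (by have := Nat.one_lt_two_pow hpos.ne'; omega) h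
  have h2 : 2 ^ m ≤ 2 ^ (minpoly (ZMod 2) (α : F)).natDegree := by
    have := Nat.one_le_two_pow (n := (minpoly (ZMod 2) (α : F)).natDegree)
    omega
  exact le_antisymm hle ((Nat.pow_le_pow_iff_right one_lt_two).mp h2)

theorem two_pow_two_mul_sub_one (e : ℕ) : 2 ^ (2 * e) - 1 = (1 + 2 ^ e) * (2 ^ e - 1) := by
  rw [mul_comm 2 e, pow_mul, add_comm 1]
  exact Nat.sq_sub_sq (2 ^ e) 1

/-- The degree `d` divides `m`, and `2^m - 1` divides `15(2^d - 1)`. A proper divisor satisfies `2d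
≤ m`, which forces `2^d < 16`. Then `15(2^d - 1) ≤ 105 < 2^8 - 1`, a contradiction. -/
theorem natDegree_minpoly_generator_pow (hF : Nat.card F = 2 ^ m) (hm : 8 ≤ m)
    (hg : Nat.gcd m (2 * e) = 4) (hα : orderOf α = 2 ^ m - 1) :
    (minpoly (ZMod 2) ((α : F) ^ (1 + 2 ^ e))).natDegree = m := by
  have h := dvd_mul_two_pow_natDegree_minpoly hα (1 + 2 ^ e)
  have hdvd := natDegree_minpoly_dvd hF ((α : F) ^ (1 + 2 ^ e))
  have hpos := minpoly.natDegree_pos (A := ZMod 2)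
    (Algebra.IsIntegral.isIntegral ((α : F) ^ (1 + 2 ^ e)))
  generalize (minpoly (ZMod 2) ((α : F) ^ (1 + 2 ^ e))).natDegree = d at *
  have h1 : 2 ^ m - 1 ∣ 15 * (2 ^ d - 1) := by
    have h2 : 2 ^ m - 1 ∣ (2 ^ (2 * e) - 1) * (2 ^ d - 1) := by
      rw [two_pow_two_mul_sub_one, mul_right_comm]
      exact h.mul_right _
    have h3 := Nat.dvd_gcd (dvd_mul_right (2 ^ m - 1) (2 ^ d - 1)) h2
    rwa [Nat.gcd_mul_right, Nat.pow_sub_one_gcd_pow_sub_one, hg] at h3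
  obtain ⟨k, rfl⟩ := hdvd
  by_contra hne
  have hk : 2 ≤ k := by
    rcases k with _ | _ | k
    · omega
    · omega
    · omega
  have h2d := Nat.one_lt_two_pow hpos.ne'
  have h4 := Nat.le_of_dvd (by omega) h1
  have h5 : 2 ^ (2 * d) ≤ 2 ^ (d * k) := Nat.pow_le_pow_right two_pos (by nlinarith)
  have h6 : (2 : ℕ) ^ (2 * d) = 2 ^ d * 2 ^ d := by rw [two_mul, pow_add]
  have h7 : 2 ^ d < 16 := by
    have h7 : 2 ^ d * 2 ^ d ≤ 15 * (2 ^ d - 1) + 1 := by omega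
    obtain ⟨z, hz⟩ : ∃ z, 2 ^ d = z + 1 := ⟨2 ^ d - 1, by omega⟩
    rw [hz, Nat.add_sub_cancel] at h7
    nlinarith
  have h8 : d < 4 := (Nat.pow_lt_pow_iff_right one_lt_two).mp (by simpa using h7)
  have h9 : (2 : ℕ) ^ 8 ≤ 2 ^ (d * k) := Nat.pow_le_pow_right two_pos hm
  have h10 : (2 : ℕ) ^ d ≤ 2 ^ 3 := Nat.pow_le_pow_right two_pos (by omega)
  omega

theorem natDegree_minpoly_generator_pow_five (hα : orderOf α = 2 ^ 4 - 1) :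
    (minpoly (ZMod 2) ((α : F) ^ 5)).natDegree = 2 := by
  have h := dvd_mul_two_pow_natDegree_minpoly hα 5
  have hpos := minpoly.natDegree_pos (A := ZMod 2) (Algebra.IsIntegral.isIntegral ((α : F) ^ 5))
  have hle : (minpoly (ZMod 2) ((α : F) ^ 5)).natDegree ≤ 2 := by
    -- Here `α^5` is a primitive cube root of unity, hence a root of `X² + X + 1`.
    have hp : (X ^ 2 + X + 1 : (ZMod 2)[X]).natDegree = 2 := by compute_degree!
    refine (natDegree_le_of_dvd (minpoly.dvd _ _ ?_) (fun h0 => by simp [h0] at hp)).trans_eq hp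
    have h3 : ((α : F) ^ 5) ^ 3 = 1 := by
      rw [← pow_mul, generator_pow_eq_one_iff hα]
      norm_num
    have h1 : (α : F) ^ 5 ≠ 1 := by
      rw [Ne, generator_pow_eq_one_iff hα]
      norm_num
    have h0 : ((α : F) ^ 5 - 1) * (((α : F) ^ 5) ^ 2 + (α : F) ^ 5 + 1) = 0 := by
      linear_combination h3
    simpa using (mul_eq_zero.mp h0).resolve_left (sub_ne_zero.mpr h1)
  interval_cases (minpoly (ZMod 2) ((α : F) ^ 5)).natDegree
  · norm_num at h
  · rfl

/-- The gcd condition forces `e ≡ 2 (mod 4)`, and 2 has order 4 modulo 5. -/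
theorem five_dvd_one_add_two_pow (hm : m % 4 = 0) (hg : Nat.gcd m e = 2) : 5 ∣ 1 + 2 ^ e := by
  have he : 2 ∣ e := hg ▸ Nat.gcd_dvd_right m e
  have he4 : e % 4 = 2 := by
    have : ¬ 4 ∣ e := fun h => by
      have := Nat.dvd_gcd (Nat.dvd_of_mod_eq_zero hm) h
      omega
    omega
  obtain ⟨t, rfl⟩ : ∃ t, e = 4 * t + 2 := ⟨e / 4, by omega⟩
  rw [pow_add, pow_mul]
  have := Nat.ModEq.pow t (show 2 ^ 4 ≡ 1 [MOD 5] from rfl)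
  rw [one_pow] at this
  unfold Nat.ModEq at this
  omega

theorem fifteen_dvd_two_pow_sub_one (hm : m % 4 = 0) : 15 ∣ 2 ^ m - 1 := by
  obtain ⟨t, rfl⟩ : ∃ t, m = 4 * t := ⟨m / 4, by omega⟩
  rw [pow_mul]
  have h := Nat.sub_dvd_pow_sub_pow (2 ^ 4) 1 t
  rw [one_pow] at h
  exact h

theorem minpoly_generator_isCoprime (hm : m % 4 = 0) (hm0 : 0 < m) (hg : Nat.gcd m e = 2)
    (hα : orderOf α = 2 ^ m - 1) :
    IsCoprime (minpoly (ZMod 2) (α : F)) (minpoly (ZMod 2) ((α : F) ^ (1 + 2 ^ e))) := by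
  obtain ⟨s, hs⟩ := fifteen_dvd_two_pow_sub_one hm
  have hpos := Nat.one_lt_two_pow hm0.ne'
  -- The exponent `3s = (2^m - 1)/5` kills `α^(1+2^e)`, since 5 divides `1 + 2^e`, but does not kill
  -- `α`.
  refine minpoly_isCoprime (n := 3 * s) ?_ ?_
  · rw [Ne, generator_pow_eq_one_iff hα]
    intro h
    have := Nat.le_of_dvd (by omega) h
    omega
  · rw [← pow_mul, generator_pow_eq_one_iff hα]
    obtain ⟨r, hr⟩ := five_dvd_one_add_two_pow hm hg
    exact ⟨r, by rw [hr, hs]; ring⟩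

theorem genPoly_dvd_X_pow_sub_one (hm : m % 4 = 0) (hm0 : 0 < m) (hg : Nat.gcd m e = 2)
    (hα : orderOf α = 2 ^ m - 1) : genPoly (α : F) {e} ∣ X ^ (2 ^ m - 1) - 1 := by
  rw [genPoly_singleton]
  have h1 : (α : F) ^ (2 ^ m - 1) = 1 := (generator_pow_eq_one_iff hα _).mpr dvd_rfl
  refine (minpoly_generator_isCoprime hm hm0 hg hα).mul_dvd (minpoly_dvd_X_pow_sub_one h1)
    (minpoly_dvd_X_pow_sub_one ?_)
  rw [← pow_mul, mul_comm, pow_mul, h1, one_pow]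

theorem finrank_extendedCode_codeE (hm : m % 4 = 0) (hm0 : 0 < m) (hg : Nat.gcd m e = 2)
    (hα : orderOf α = 2 ^ m - 1) (hF : Nat.card F = 2 ^ m) :
    Module.finrank (ZMod 2) (extendedCode (codeE m (α : F) {e})) +
      (m + (minpoly (ZMod 2) ((α : F) ^ (1 + 2 ^ e))).natDegree) = 2 ^ m - 1 := by
  have h1 : (minpoly (ZMod 2) (α : F)).Monic := minpoly.monic (Algebra.IsIntegral.isIntegral _)
  have h2 : (minpoly (ZMod 2) ((α : F) ^ (1 + 2 ^ e))).Monic :=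
    minpoly.monic (Algebra.IsIntegral.isIntegral _)
  have hdvd := genPoly_dvd_X_pow_sub_one hm hm0 hg hα
  have hpos := Nat.one_lt_two_pow hm0.ne'
  have hdeg : (genPoly (α : F) {e}).natDegree ≤ 2 ^ m - 1 := by
    have hX : (X ^ (2 ^ m - 1) - 1 : (ZMod 2)[X]).Monic := monic_X_pow_sub_C 1 (by omega)
    refine (natDegree_le_of_dvd hdvd hX.ne_zero).trans_eq ?_
    exact natDegree_X_pow_sub_C
  have h := finrank_cyclicCode_add_natDegree
    (by rw [genPoly_singleton]; exact h1.mul h2) hdeg hdvd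
  rw [finrank_extendedCode, codeE]
  rwa [genPoly_singleton, h1.natDegree_mul h2, natDegree_minpoly_generator hF hm0 hα,
    ← genPoly_singleton] at h

theorem mem_extendedCode_codeE_iff (hm : m % 4 = 0) (hm0 : 0 < m) (hg : Nat.gcd m e = 2)
    (hα : orderOf α = 2 ^ m - 1) (c : Fin (2 ^ m - 1 + 1) → ZMod 2) :
    c ∈ extendedCode (codeE m (α : F) {e}) ↔
      (∑ i, c i = 0 ∧ ∑ i, c i • codePoint m (α : F) i = 0 ∧
        ∑ i, c i • codePoint m (α : F) i ^ (1 + 2 ^ e) = 0) := by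
  rw [mem_extendedCode_iff, codeE, mem_cyclicCode_iff (genPoly_dvd_X_pow_sub_one hm hm0 hg hα),
    genPoly_singleton]
  refine and_congr_right fun _ => ?_
  have hmul : ∀ p : (ZMod 2)[X],
      minpoly (ZMod 2) (α : F) * minpoly (ZMod 2) ((α : F) ^ (1 + 2 ^ e)) ∣ p ↔
      minpoly (ZMod 2) (α : F) ∣ p ∧ minpoly (ZMod 2) ((α : F) ^ (1 + 2 ^ e)) ∣ p := fun p =>
    ⟨fun h => ⟨dvd_of_mul_right_dvd h, dvd_of_mul_left_dvd h⟩,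
      fun h => (minpoly_generator_isCoprime hm hm0 hg hα).mul_dvd h.1 h.2⟩
  rw [hmul, minpoly.dvd_iff, minpoly.dvd_iff, Fin.sum_univ_castSucc, Fin.sum_univ_castSucc]
  simp only [codePoint, Fin.snoc_castSucc, Fin.snoc_last, add_zero, map_sum, map_mul,
    aeval_C, map_pow, aeval_X, Algebra.smul_def, mul_zero, ← pow_mul, mul_comm (1 + 2 ^ e)]
  -- The parity coordinate sits at the point `0`, so it does not enter the power-sum checks.
  rw [zero_pow (by positivity), mul_zero, add_zero]

end MinimalPolynomials

/-! ### Minimum distance. -/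

section MinimumDistance

variable {F : Type*} [Field F] [Fintype F] [DecidableEq F] {m e : ℕ}

theorem card_subfield_four (hm : m % 4 = 0) (hF : Fintype.card F = 2 ^ m) :
    (Finset.univ.filter fun x : F => x ^ 4 = x).card = 4 := by
  rw [card_eq_card_units_add_one (by simp)]
  have h := card_units_pow_two_pow_sub_one hF 2
  rw [Nat.gcd_eq_right (by omega)] at h
  suffices h' : (Finset.univ.filter fun z : Fˣ =>
      (z : F) ∈ Finset.univ.filter fun x : F => x ^ 4 = x) = Finset.univ.filter fun x : Fˣ => x ^ (2 ^ 2 - 1) = 1 by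
    rw [h', h]
    norm_num
  ext z
  simp only [Finset.mem_filter, Finset.mem_univ, true_and]
  rw [← Units.val_pow_eq_pow_val, Units.val_inj, pow_succ, mul_eq_right]
  norm_num

/-- Multiplication by a cube root of unity `ω ≠ 1` permutes the subfield, so the sum is fixed by `ω`
and must vanish. -/
theorem sum_subfield_four (hm : m % 4 = 0) (hF : Fintype.card F = 2 ^ m) :
    ∑ x : F with x ^ 4 = x, x = 0 := by
  have h := card_units_pow_two_pow_sub_one hF 2
  rw [Nat.gcd_eq_right (by omega)] at h
  obtain ⟨ω, hω, hω1⟩ := Finset.exists_mem_ne (by rw [h]; norm_num) (1 : Fˣ)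
  have hω3 : (ω : F) ^ 3 = 1 := by
    rw [← Units.val_pow_eq_pow_val, Units.val_eq_one]
    exact (Finset.mem_filter.mp hω).2
  have key : ∑ x : F with x ^ 4 = x, x = ∑ x : F with x ^ 4 = x, ω * x := by
    symm
    refine Finset.sum_bij (fun x _ => ω * x) ?_ ?_ ?_ (fun _ _ => rfl)
    · intro x hx
      rw [Finset.mem_filter] at hx ⊢
      refine ⟨Finset.mem_univ _, ?_⟩
      rw [mul_pow, hx.2, pow_succ, hω3, one_mul]
    · intro x _ y _ hxy
      exact mul_left_cancel₀ ω.ne_zero hxy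
    · intro y hy
      rw [Finset.mem_filter] at hy
      refine ⟨ω ^ 2 * y, ?_, ?_⟩
      · rw [Finset.mem_filter]
        refine ⟨Finset.mem_univ _, ?_⟩
        rw [mul_pow, hy.2]
        linear_combination (ω ^ 5 + ω ^ 2 : F) * y * hω3
      · linear_combination y * hω3
  rw [← Finset.mul_sum] at key
  have h1 : (ω : F) - 1 ≠ 0 := sub_ne_zero.mpr (by rwa [Ne, Units.val_eq_one])
  refine (mul_eq_zero.mp (?_ : ((ω : F) - 1) * _ = 0)).resolve_left h1
  linear_combination -key

variable [Algebra (ZMod 2) F]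

/-- The indicator of the subfield of order 4 is a codeword: as `e` is even, `x^(1+2^e) = x²` there,
and the last check is the square of the second. Conversely, weights are even, and weight 2 would
make two distinct points sum to zero. -/
theorem isMinDistance_extendedCode_codeE (hm : m % 4 = 0) (hm0 : 0 < m) (hg : Nat.gcd m e = 2)
    (hF : Fintype.card F = 2 ^ m) {α : Fˣ} (hα : orderOf α = 2 ^ m - 1) :
    IsMinDistance (extendedCode (codeE m (α : F) {e})) 4 := by
  have hF' : Nat.card F = 2 ^ m := by rw [Nat.card_eq_fintype_card, hF]
  have hbij := codePoint_bijective hα hF'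
  have hchar : CharP F 2 := charP_of_injective_algebraMap (algebraMap (ZMod 2) F).injective 2
  constructor
  · let f : F → ZMod 2 := fun x => if x ^ 4 = x then 1 else 0
    have hnorm : hammingNorm (fun i => f (codePoint m (α : F) i)) = 4 := by
      rw [hammingNorm, ← card_subfield_four hm hF]
      refine Finset.card_bij (fun i _ => codePoint m (α : F) i) ?_ ?_ ?_
      · intro i hi
        simpa [f] using hi
      · intro i _ j _ h
        exact hbij.injective h
      · intro x hx
        obtain ⟨i, rfl⟩ := hbij.surjective x
        exact ⟨i, by simpa [f] using hx, rfl⟩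
    have hsum : ∀ g : F → F, ∑ i, f (codePoint m (α : F) i) • g (codePoint m (α : F) i) =
        ∑ x : F with x ^ 4 = x, g x := by
      intro g
      rw [hbij.sum_comp (fun x => f x • g x), Finset.sum_filter]
      refine Finset.sum_congr rfl fun x _ => ?_
      simp [f]
    refine ⟨_, (mem_extendedCode_codeE_iff hm hm0 hg hα _).mpr ⟨?_, ?_, ?_⟩, ?_, hnorm⟩
    · rw [sum_eq_hammingNorm, hnorm]
      rfl
    · rw [hsum (fun x => x), sum_subfield_four hm hF]
    · rw [hsum (fun x => x ^ (1 + 2 ^ e))]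
      obtain ⟨t, rfl⟩ : 2 ∣ e := hg ▸ Nat.gcd_dvd_right m e
      have hx : ∀ x : F, x ^ 4 = x → x ^ (1 + 2 ^ (2 * t)) = x ^ 2 := by
        intro x hx
        have h4 : x ^ 2 ^ (2 * t) = x := by
          rw [pow_mul]
          clear hg
          induction t with
          | zero => simp
          | succ t ih => rw [pow_succ, pow_mul, ih]; exact hx
        rw [pow_add, h4, pow_one, sq]
      rw [Finset.sum_congr rfl (fun x hx' => hx x (Finset.mem_filter.mp hx').2),
        ← sum_pow_char, sum_subfield_four hm hF, zero_pow two_ne_zero]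
    · intro h0
      rw [h0, hammingNorm_zero] at hnorm
      omega
  · rintro w ⟨c, hc, hc0, rfl⟩
    obtain ⟨h1, h2, -⟩ := (mem_extendedCode_codeE_iff hm hm0 hg hα c).mp hc
    rw [sum_eq_hammingNorm, ZMod.natCast_eq_zero_iff_even] at h1
    have hn0 : hammingNorm c ≠ 0 := hammingNorm_ne_zero_iff.mpr hc0
    have hn2 : hammingNorm c ≠ 2 := by
      intro hn
      rw [hammingNorm] at hn
      obtain ⟨i, j, hij, hs⟩ := Finset.card_eq_two.mp hn
      have hone : ∀ k ∈ ({i, j} : Finset _), c k = 1 := by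
        intro k hk
        rw [← hs, Finset.mem_filter] at hk
        have h := hk.2
        generalize c k = t at h
        revert t
        decide
      apply hij
      apply hbij.injective
      rw [← Finset.sum_subset (Finset.subset_univ {i, j})] at h2
      · rw [Finset.sum_pair hij, hone i (by simp), hone j (by simp), one_smul, one_smul] at h2
        rwa [← CharTwo.sub_eq_add, sub_eq_zero] at h2
      · intro k _ hk
        rw [← hs, Finset.mem_filter, not_and_not_right] at hk
        rw [hk (Finset.mem_univ _), zero_smul]
    obtain ⟨r, hr⟩ := h1
    omega

end MinimumDistance

/-! ### Value distribution of the sums and the weight formula. -/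

section WeightDistribution

theorem sum_eq_add_sum_units {F M : Type*} [Field F] [Fintype F] [DecidableEq F] [AddCommMonoid M]
    (f : F → M) : ∑ x, f x = f 0 + ∑ x : Fˣ, f x := by
  rw [Fintype.sum_eq_add_sum_subtype_ne f 0,
    ← unitsEquivNeZero.sum_comp (fun x : {x : F // x ≠ 0} => f x)]
  rfl

variable {F : Type*} [Field F] [Fintype F] [DecidableEq F]

/-- This sums any function of `(a, b)` that is constant on each level of `S²`, with `(0, 0)` kept
apart. The factor `80 = 5 · 16` clears two denominators: a fifth of the nonzero `b` are degenerate,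
and for those a sixteenth of the `a` give `S ≠ 0`. -/
theorem sum_sum_of_quadSum [CharP F 2] {m e : ℕ} (hF : Fintype.card F = 2 ^ m) (hm : m % 4 = 0)
    (hg : Nat.gcd m e = 2) {ψ : AddChar F ℚ} (hψ : ψ.IsPrimitive)
    (hfrob : ∀ x, ψ (x ^ 2) = ψ x) (G : F → F → ℚ) {Z A₁ A₂ : ℚ}
    (hZ : ∀ a b, quadSum ψ e a b ^ 2 = 0 → G a b = Z)
    (h₁ : ∀ a b, quadSum ψ e a b ^ 2 = 16 * 2 ^ m → G a b = A₁)
    (h₂ : ∀ a b, quadSum ψ e a b ^ 2 = 2 ^ m → G a b = A₂) :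
    80 * ∑ a, ∑ b, G a b = 80 * G 0 0 + (2 ^ m - 1) *
      ((80 + 15 * 2 ^ m) * Z + 2 ^ m * A₁ + 64 * 2 ^ m * A₂) := by
  have hFQ : (Fintype.card F : ℚ) = 2 ^ m := by rw [hF]; norm_num
  have hunits : (Fintype.card Fˣ : ℚ) = 2 ^ m - 1 := by
    rw [Fintype.card_units, Nat.cast_sub Fintype.card_pos, hFQ, Nat.cast_one]
  have hb0 : ∑ a, G a 0 = G 0 0 + (2 ^ m - 1) * Z := by
    rw [sum_eq_add_sum_units, ← hunits, Finset.sum_congr rfl (g := fun _ => Z)]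
    · simp
    · intro a _
      exact hZ _ _ (by rw [quadSum_zero_right hψ e a.ne_zero]; norm_num)
  have hb : ∀ b : Fˣ, 16 * ∑ a, G a b = if (quadRadical e (b : F)).card = 16 then
      2 ^ m * A₁ + 15 * 2 ^ m * Z else 16 * 2 ^ m * A₂ := by
    intro b
    split_ifs with h
    · have hn := card_quadSum_ne_zero hψ hfrob e (b : F)
      rw [h, hFQ] at hn
      have hc := Finset.card_filter_add_card_filter_not (s := (Finset.univ : Finset F))
        (fun a => quadSum ψ e a b ≠ 0)
      rw [Finset.card_univ] at hc
      have hc' : ((Finset.univ.filter fun a => quadSum ψ e a (b : F) ≠ 0).card : ℚ) +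
        (Finset.univ.filter fun a => ¬ quadSum ψ e a (b : F) ≠ 0).card = 2 ^ m := by
        rw [← hFQ, ← hc]; push_cast; rfl
      rw [← Finset.sum_filter_add_sum_filter_not Finset.univ (fun a => quadSum ψ e a b ≠ 0),
        Finset.sum_congr rfl (g := fun _ => A₁),
        Finset.sum_congr (s₁ := Finset.univ.filter fun a => ¬ quadSum ψ e a (b : F) ≠ 0) rfl
          (g := fun _ => Z), Finset.sum_const, Finset.sum_const, nsmul_eq_mul, nsmul_eq_mul]
      · push_cast at hn
        linear_combination (A₁ - Z) * hn + 16 * Z * hc'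
      · intro a ha
        apply hZ
        rw [not_not.mp (Finset.mem_filter.mp ha).2]
        norm_num
      · intro a ha
        apply h₁
        rw [(quadSum_sq_eq_zero_or hψ hfrob e a (b : F)).resolve_left
          (pow_ne_zero 2 (Finset.mem_filter.mp ha).2), h, hFQ]
        norm_num [mul_comm]
    · have h1 := (card_quadRadical_eq_one_or hF (gcd_two_mul_eq_four hm hg) b).resolve_right h
      rw [Finset.sum_congr rfl (g := fun _ => A₂)]
      · simp [hFQ, mul_assoc]
      · intro a _
        exact h₂ _ _ (by rw [quadSum_sq_of_card_radical_eq_one hψ hfrob h1, hFQ])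
  have h5 := five_mul_card_degenerate hF hm hg
  have h5Q : 5 * ((Finset.univ.filter fun b : Fˣ => (quadRadical e (b : F)).card = 16).card : ℚ) =
      2 ^ m - 1 := by
    rw [← hunits, Fintype.card_units, hF, ← h5]
    push_cast
    rfl
  have hc := Finset.card_filter_add_card_filter_not (s := (Finset.univ : Finset Fˣ))
    (fun b => (quadRadical e (b : F)).card = 16)
  rw [Finset.card_univ] at hc
  have hc' : ((Finset.univ.filter fun b : Fˣ => (quadRadical e (b : F)).card = 16).card : ℚ) +
      (Finset.univ.filter fun b : Fˣ => ¬ (quadRadical e (b : F)).card = 16).card = 2 ^ m - 1 := by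
    rw [← hunits, ← hc]; push_cast; rfl
  have hsum : 16 * ∑ b : Fˣ, ∑ a, G a b =
      (Finset.univ.filter fun b : Fˣ => (quadRadical e (b : F)).card = 16).card *
        (2 ^ m * A₁ + 15 * 2 ^ m * Z) +
      (Finset.univ.filter fun b : Fˣ => ¬ (quadRadical e (b : F)).card = 16).card *
        (16 * 2 ^ m * A₂) := by
    rw [Finset.mul_sum, Finset.sum_congr rfl (fun b _ => hb b), Finset.sum_ite, Finset.sum_const,
      Finset.sum_const, nsmul_eq_mul, nsmul_eq_mul]
  rw [Finset.sum_comm, sum_eq_add_sum_units, hb0]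
  linear_combination 5 * hsum + (2 ^ m * A₁ + 15 * 2 ^ m * Z - 16 * 2 ^ m * A₂) * h5Q +
    5 * (16 * 2 ^ m * A₂) * hc'

variable [Algebra (ZMod 2) F] {m e : ℕ}

theorem weightCount_extendedCode_codeE (hm : m % 4 = 0) (hm4 : 4 ≤ m) (hg : Nat.gcd m e = 2)
    (hF : Fintype.card F = 2 ^ m) {α : Fˣ} (hα : orderOf α = 2 ^ m - 1) (k : ℕ) :
    (2 : ℚ) ^ (2 * m + 1) * (weightCount (extendedCode (codeE m (α : F) {e})) k : ℚ) =
      (1 + (-1) ^ k) * ((2 ^ m).choose k : ℚ) + wConst m * E0 m k + uConst m * E1 m k +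
        vConst m * E2 m k := by
  have hF' : Nat.card F = 2 ^ m := by rw [Nat.card_eq_fintype_card, hF]
  have hbij := codePoint_bijective hα hF'
  have hchar : CharP F 2 := charP_of_injective_algebraMap (algebraMap (ZMod 2) F).injective 2
  obtain ⟨ψ, hψ, hfrob⟩ := exists_frobenius_invariant_addChar (F := F)
  obtain ⟨r, rfl⟩ : ∃ r, m = 2 * r + 4 := ⟨(m - 4) / 2, by omega⟩
  have hcount : weightCount (extendedCode (codeE (2 * r + 4) (α : F) {e})) k =
      (Finset.univ.filter fun c : Fin (2 ^ (2 * r + 4) - 1 + 1) → ZMod 2 => hammingNorm c = k ∧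
        (∑ i, c i = 0 ∧ ∑ i, c i • codePoint (2 * r + 4) (α : F) i = 0 ∧
          ∑ i, c i • codePoint (2 * r + 4) (α : F) i ^ (1 + 2 ^ e) = 0)).card := by
    rw [weightCount, ← Set.ncard_coe_finset]
    congr 1
    ext c
    simp only [Set.mem_ofPred_eq, Finset.coe_filter, Finset.mem_univ, true_and]
    rw [mem_extendedCode_codeE_iff hm (by omega) hg hα, and_comm]
  have hmw := macWilliams hψ (codePoint (2 * r + 4) (α : F))
    (fun i => codePoint (2 * r + 4) (α : F) i ^ (1 + 2 ^ e)) k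
  rw [← hcount, hF] at hmw
  set G : F → F → ℚ := fun a b => (∏ x : F, (1 + C (ψ (a * x + b * x ^ (1 + 2 ^ e))) * X : ℚ[X]) +
    ∏ x : F, (1 + C (-ψ (a * x + b * x ^ (1 + 2 ^ e))) * X : ℚ[X])).coeff k with hG
  have hprod : ∀ a b, (∏ i, (1 + C (ψ (a * codePoint (2 * r + 4) (α : F) i +
        b * codePoint (2 * r + 4) (α : F) i ^ (1 + 2 ^ e))) * X : ℚ[X]) +
      ∏ i, (1 + C (-ψ (a * codePoint (2 * r + 4) (α : F) i +
        b * codePoint (2 * r + 4) (α : F) i ^ (1 + 2 ^ e))) * X : ℚ[X])).coeff k = G a b := by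
    intro a b
    rw [hG, hbij.prod_comp (fun x => (1 + C (ψ (a * x + b * x ^ (1 + 2 ^ e))) * X : ℚ[X])),
      hbij.prod_comp (fun x => (1 + C (-ψ (a * x + b * x ^ (1 + 2 ^ e))) * X : ℚ[X]))]
  simp_rw [hprod] at hmw
  have hcoeff : ∀ (a b : F) (t : ℕ), t ≤ 2 ^ (2 * r + 3) →
      quadSum ψ e a b ^ 2 = (2 * t : ℚ) ^ 2 →
      G a b = binomSum (2 ^ (2 * r + 3) - t) (2 ^ (2 * r + 3) + t) k := fun a b t ht hS =>
    coeff_prod_sign_add _ (fun x => addChar_eq_one_or ψ _) (by rw [hF]; ring) ht hS k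
  have h00 : G 0 0 = (1 + (-1) ^ k) * ((2 ^ (2 * r + 4)).choose k : ℚ) := by
    rw [hcoeff 0 0 (2 ^ (2 * r + 3)) le_rfl, Nat.sub_self, binomSum_zero_left]
    · congr 3
      ring
    · rw [quadSum_zero_zero, hF]
      push_cast
      ring
  -- The factor 2 in `Z` undoes the division by 2 in `E0`.
  have hsum := sum_sum_of_quadSum hF hm hg hψ hfrob G (Z := 2 * E0 (2 * r + 4) k)
    (A₁ := E1 (2 * r + 4) k) (A₂ := E2 (2 * r + 4) k) ?_ ?_ ?_
  · rw [← hmw, h00] at hsum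
    rw [wConst, uConst, vConst, show 2 * r + 4 - 4 = 2 * r by omega,
      show (2 : ℚ) ^ (2 * (2 * r + 4) + 1) = 2 * (2 ^ (2 * r + 4)) ^ 2 by ring]
    push_cast at hsum
    simp only [pow_add] at hsum ⊢
    linear_combination hsum / 80
  · intro a b hS
    rw [hcoeff a b 0 (Nat.zero_le _) (by rw [hS]; norm_num), Nat.sub_zero, add_zero,
      binomSum_self, E0]
    simp only [show 2 * r + 4 - 1 = 2 * r + 3 by omega]
    ring
  · intro a b hS
    -- In `hcoeff`, `t = |S|/2`. Here `|S| = 4 · 2^(m/2) = 2^(r+4)`, and in the next case `|S| =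
    -- 2^(m/2) = 2^(r+2)`.
    rw [hcoeff a b (2 ^ (r + 3)) (Nat.pow_le_pow_right two_pos (by omega)), E1,
      show 2 * r + 4 - 1 = 2 * r + 3 by omega, show (2 * r + 4 + 2) / 2 = r + 3 by omega]
    rw [hS]
    push_cast
    ring
  · intro a b hS
    rw [hcoeff a b (2 ^ (r + 1)) (Nat.pow_le_pow_right two_pos (by omega)), E2,
      show 2 * r + 4 - 1 = 2 * r + 3 by omega, show (2 * r + 4 - 2) / 2 = r + 1 by omega]
    rw [hS]
    push_cast
    ring

end WeightDistribution

end BinaryCode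

theorem mainTheorem7 (m e : ℕ) (hm : m % 4 = 0) (he1 : 1 ≤ e) (he2 : e ≤ m / 2)
    (hgcd : Nat.gcd m e = 2)
    {F : Type*} [Field F] [Finite F] [Algebra (ZMod 2) F] (hF : Nat.card F = 2 ^ m)
    (α : Fˣ) (hα : ∀ x : Fˣ, x ∈ Subgroup.zpowers α) :
    2 ^ m - 1 + 1 = 2 ^ m ∧
    (m ≠ 4 → (Module.finrank (ZMod 2)
      (BinaryCode.extendedCode (BinaryCode.codeE m (α : F) {e})) : ℤ) = 2 ^ m - 1 - 2 * m) ∧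
    (m = 4 → Module.finrank (ZMod 2)
      (BinaryCode.extendedCode (BinaryCode.codeE m (α : F) {e})) = 9) ∧
    BinaryCode.IsMinDistance (BinaryCode.extendedCode (BinaryCode.codeE m (α : F) {e})) 4 ∧
    ∀ k : ℕ, k ≤ 2 ^ m →
      (2 : ℚ) ^ (2 * m + 1) *
          (BinaryCode.weightCount (BinaryCode.extendedCode (BinaryCode.codeE m (α : F) {e})) k : ℚ)
        = (1 + (-1) ^ k) * ((2 ^ m).choose k : ℚ)
          + BinaryCode.wConst m * BinaryCode.E0 m k
          + BinaryCode.uConst m * BinaryCode.E1 m k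
          + BinaryCode.vConst m * BinaryCode.E2 m k := by

  have hm4 : 4 ≤ m := by
    -- The case `m = 0` is excluded by `1 ≤ e ≤ m / 2`.
    rcases Nat.eq_zero_or_pos m with rfl | h <;> omega
  have hord := BinaryCode.orderOf_generator hF hα
  have hdim := BinaryCode.finrank_extendedCode_codeE hm (by omega) hgcd hord hF
  have hpos := Nat.one_le_two_pow (n := m)
  have := Fintype.ofFinite F
  classical
  have hF' : Fintype.card F = 2 ^ m := by rw [← Nat.card_eq_fintype_card, hF]
  refine ⟨Nat.sub_add_cancel hpos, ?_, ?_,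
    BinaryCode.isMinDistance_extendedCode_codeE hm (by omega) hgcd hF' hord,
    fun k _ => BinaryCode.weightCount_extendedCode_codeE hm hm4 hgcd hF' hord k⟩
  · intro hne
    rw [BinaryCode.natDegree_minpoly_generator_pow hF (by omega)
      (BinaryCode.gcd_two_mul_eq_four hm hgcd) hord] at hdim
    zify [hpos] at hdim
    linarith
  · rintro rfl
    -- With `e = 2` the second root is `α^5`, of degree 2, so the dimension is `15 - (4 + 2) = 9`.
    obtain rfl : e = 2 := by
      interval_cases e <;> simp_all
    have h5 := BinaryCode.natDegree_minpoly_generator_pow_five hord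
    norm_num at hdim
    rw [h5] at hdim
    omega
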